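/- Let $x,y\in\mathbb R$ satisfy $x^2+y^2+x+y+xy=0$ and $-1\le x\le \tfrac13$, and let $$C=\begin{pmatrix} x & y & -1-x-y\\ -1-x-y & x & y\\ y & -1-x-y & x\end{pmatrix}$$ (the matrices of this form make up the class $\mathcal Y$). Consider the three-state quantum walk on $\ell^2(\mathbb Z)\otimes\mathbb C^3$ with one-step operator $U=S(I\otimes C)$, where $$S=\sum_{m\in\mathbb Z}\bigl(|m-1\rangle\langle m|\otimes|1\rangle\langle 1|+|m\rangle\langle m|\otimes|2\rangle\langle 2|+|m+1\rangle\langle m|\otimes|3\rangle\langle 3|\bigr),$$ started from $|0\rangle\otimes\varphi$ with $\varphi=(\alpha,\beta,\gamma)^T\in\mathbb C^3$, $|\alpha|^2+|\beta|^2+|\gamma|^2=1$. Let $P(m,t)=\sum_{l=1}^3\bigl|\langle m,l|U^t|0,\varphi\rangle\bigr|^2$ be the probability of finding the walker at $m$ after $t$ steps. Assume $x\ne 0$ and $x\neq -1$. Then for every such $\varphi$ the limit $\lim_{t\to\infty}P(0,t)$ exists, and the following are equivalent: 1. $\lim_{t\to\infty}P(0,t)=0$; 2. up to a global phase, $\varphi$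 is the state $$\Psi_{\mathcal Y}=\frac1N\bigl(-(1+x+y),\;1+x,\;y\bigr)^T,\qquad N=\sqrt{(1+x+y)^2+(1+x)^2+y^2},$$ that is, $\varphi=c\,\Psi_{\mathcal Y}$ for some $c\in\mathbb C$ with $|c|=1$; 3. $D=E=0$, where $D=\alpha(1+x)+\beta(1+x+y)$ and $E=\gamma(1+x)-\beta y$. Moreover, for every $k\in\mathbb R$ the matrix $\tilde U(k)=\operatorname{diag}(e^{ik},1,e^{-ik})\,C$, which describes the walk in momentum space, has the eigenvalue $-1$, and $\Psi_{\mathcal Y}$ is orthogonal to every eigenvector of $\tilde U(k)$ for this eigenvalue. -/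

import Mathlib

open Filter Topology

noncomputable section

namespace ThreeStateWalk

/-- The state space `ℓ²(ℤ) ⊗ ℂ³`, realised as `ℓ²(ℤ × {1,2,3})`; the coordinate at `(m, l)` is the
amplitude of `|m⟩ ⊗ |l⟩`. The coin labels `1, 2, 3` are the elements `0, 1, 2` of `Fin 3`. -/
abbrev State : Type := lp (fun _ : ℤ × Fin 3 => ℂ) 2

/-- Displacement of the walker for each coin label: left, stay, right. -/
def disp : Fin 3 → ℤ := ![-1, 0, 1]

theorem memlp_comp {f : ℤ × Fin 3 → ℂ} (hf : Memℓp (E := fun _ : ℤ × Fin 3 => ℂ) f 2)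
    {g : ℤ × Fin 3 → ℤ × Fin 3} (hg : Function.Injective g) :
    Memℓp (E := fun _ : ℤ × Fin 3 => ℂ) (fun p => f (g p)) 2 := by
  have h2 : 0 < (2 : ENNReal).toReal := by norm_num
  rw [memℓp_gen_iff h2] at hf ⊢
  exact hf.comp_injective hg

theorem memlp_coin (C : Matrix (Fin 3) (Fin 3) ℂ) {f : ℤ × Fin 3 → ℂ}
    (hf : Memℓp (E := fun _ : ℤ × Fin 3 => ℂ) f 2) :
    Memℓp (E := fun _ : ℤ × Fin 3 => ℂ) (fun p => ∑ j, C p.2 j * f (p.1, j)) 2 := by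
  have h2 : 0 < (2 : ENNReal).toReal := by norm_num
  have key : ∀ j : Fin 3,
      Memℓp (E := fun _ : ℤ × Fin 3 => ℂ) (fun p => C p.2 j * f (p.1, j)) 2 := by
    intro j
    have hj : Summable fun m : ℤ => ‖f (m, j)‖ ^ (2 : ENNReal).toReal :=
      ((memℓp_gen_iff h2).1 hf).comp_injective
        (i := fun m : ℤ => (m, j)) (fun a b h => (Prod.mk.inj h).1)
    rw [memℓp_gen_iff h2]
    have hfin : Summable fun l : Fin 3 => ‖C l j‖ ^ (2 : ENNReal).toReal :=
      Summable.of_finite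
    have hprod := hj.mul_of_nonneg hfin (fun _ => by positivity) (fun _ => by positivity)
    refine hprod.congr fun p => ?_
    rw [norm_mul, Real.mul_rpow (norm_nonneg _) (norm_nonneg _), mul_comm]
  exact Memℓp.finsetSum Finset.univ fun j _ => key j

/-- The conditional shift
`S = ∑ₘ (|m-1⟩⟨m| ⊗ |1⟩⟨1| + |m⟩⟨m| ⊗ |2⟩⟨2| + |m+1⟩⟨m| ⊗ |3⟩⟨3|)`. -/
def shift : State →ₗ[ℂ] State where
  toFun ψ := ⟨fun p => ψ (p.1 - disp p.2, p.2), memlp_comp (lp.memℓp ψ)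
    (g := fun p => (p.1 - disp p.2, p.2)) (by
      rintro ⟨a, l⟩ ⟨b, l'⟩ h
      obtain ⟨h1, rfl⟩ := Prod.mk.inj h
      exact Prod.ext (sub_left_injective h1) rfl)⟩
  map_add' _ _ := rfl
  map_smul' _ _ := rfl

/-- The operator `I ⊗ C`. -/
def coinOp (C : Matrix (Fin 3) (Fin 3) ℂ) : State →ₗ[ℂ] State where
  toFun ψ := ⟨fun p => ∑ j, C p.2 j * ψ (p.1, j), memlp_coin C (lp.memℓp ψ)⟩
  map_add' ψ φ := by
    ext p
    change ∑ j, C p.2 j * (ψ (p.1, j) + φ (p.1, j))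
      = ∑ j, C p.2 j * ψ (p.1, j) + ∑ j, C p.2 j * φ (p.1, j)
    simp only [mul_add, Finset.sum_add_distrib]
  map_smul' c ψ := by
    ext p
    change ∑ j, C p.2 j * (c * ψ (p.1, j)) = c * ∑ j, C p.2 j * ψ (p.1, j)
    simp only [Finset.mul_sum, mul_left_comm]

/-- One step of the walk, `U = S (I ⊗ C)`. -/
def evolution (C : Matrix (Fin 3) (Fin 3) ℂ) : Module.End ℂ State :=
  shift ∘ₗ coinOp C

/-- The initial state `|0⟩ ⊗ φ`. -/
def initial (φ : EuclideanSpace ℂ (Fin 3)) : State :=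
  ∑ l, lp.single 2 ((0 : ℤ), l) (φ l)

/-- `P(m,t)`: the probability of finding the walker at `m` after `t` steps, when it starts at the
origin with coin state `φ`. -/
def prob (C : Matrix (Fin 3) (Fin 3) ℂ) (φ : EuclideanSpace ℂ (Fin 3)) (m : ℤ) (t : ℕ) : ℝ :=
  ∑ l, ‖((evolution C ^ t) (initial φ)) (m, l)‖ ^ 2

/-- The coin with parameters `x, y`. -/
def coin (x y : ℝ) : Matrix (Fin 3) (Fin 3) ℝ :=
  !![x, y, -1 - x - y;
     -1 - x - y, x, y;
     y, -1 - x - y, x]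

/-- The coin class `𝒴`. -/
def coinClassY : Set (Matrix (Fin 3) (Fin 3) ℝ) :=
  {C | ∃ x y : ℝ, x ^ 2 + y ^ 2 + x + y + x * y = 0 ∧ -1 ≤ x ∧ x ≤ 1 / 3 ∧ C = coin x y}

/-- A real matrix regarded as a complex one. -/
def toComplex (C : Matrix (Fin 3) (Fin 3) ℝ) : Matrix (Fin 3) (Fin 3) ℂ :=
  C.map (fun r => (r : ℂ))

/-- The evolution in momentum space, `diag(e^{ik}, 1, e^{-ik}) C`. -/
def momentumEvolution (C : Matrix (Fin 3) (Fin 3) ℂ) (k : ℝ) : Matrix (Fin 3) (Fin 3) ℂ :=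
  Matrix.diagonal ![Complex.exp (Complex.I * k), 1, Complex.exp (-(Complex.I * k))] * C

/-- The unit vector `(1/N) (-(1+x+y), 1+x, y)ᵀ`, `N = √((1+x+y)² + (1+x)² + y²)`. -/
def exceptionalState (x y : ℝ) : EuclideanSpace ℂ (Fin 3) :=
  ((1 / √((1 + x + y) ^ 2 + (1 + x) ^ 2 + y ^ 2) : ℝ) : ℂ) •
    !₂[-(1 + (x : ℂ) + (y : ℂ)), 1 + (x : ℂ), (y : ℂ)]

end ThreeStateWalk

end

noncomputable section

namespace ThreeStateWalk

open Polynomial Complex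

/-! In momentum space U has characteristic polynomial (λ + 1)(λ² - 2hλ + 1), h = (1+x)/2 + x cos k,
so on the range of U + 1 its powers are Chebyshev polynomials in `halfTrace`
(`walkOp_pow_eq_chebyshev`). Their matrix entries are Fourier integrals of U_n(h). With an extra
factor sin k these integrate by parts to T_n(h)/n, and |T_n(h)| ≤ 1. Hence, with T the translation
by one site, (U + 1)(T - T⁻¹) sends every basis state to a state that decays pointwise.

Decaying states form a closed subspace, as U is isometric, and its orthogonal complement lies in the
eigenspace of -1 (`walkOp_eq_neg_of_mem_orthogonal`). Splitting the initial state as g + ξ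
accordingly gives P(0,t) → ∑ |ξ(0,l)|². The initial state lives at the origin, so this limit
vanishes only if ξ = 0. The initial state is then orthogonal to the eigenvectors `boundState`, which
says D = E = 0. Conversely, one coordinate at the origin of Uξ = -ξ makes every such ξ orthogonal to
an initial state with D = E = 0. -/

/-! ### The walk operator and its Chebyshev recurrence -/

/-- The evolution operator of the walk whose coin is `coin x y`. -/
abbrev walkOp (x y : ℝ) : Module.End ℂ State := evolution (toComplex (coin x y))

/-- The basis state `|m⟩ ⊗ |l⟩`. -/
abbrev basisState (p : ℤ × Fin 3) : State := lp.single 2 p (1 : ℂ)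

/-- Translation of the walker by `d` sites. -/
def translate (d : ℤ) : Module.End ℂ State where
  toFun ψ := ⟨fun p => ψ (p.1 - d, p.2), memlp_comp (lp.memℓp ψ)
    (g := fun p => (p.1 - d, p.2)) (by
      rintro ⟨a, l⟩ ⟨b, l'⟩ h
      obtain ⟨h1, rfl⟩ := Prod.mk.inj h
      exact Prod.ext (sub_left_injective h1) rfl)⟩
  map_add' _ _ := rfl
  map_smul' _ _ := rfl

theorem translate_apply (d : ℤ) (ψ : State) (m : ℤ) (l : Fin 3) :
    translate d ψ (m, l) = ψ (m - d, l) := rfl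

theorem evolution_apply (C : Matrix (Fin 3) (Fin 3) ℂ) (ψ : State) (m : ℤ) (l : Fin 3) :
    evolution C ψ (m, l) = ∑ j, C l j * ψ (m - disp l, j) := rfl

theorem walkOp_apply_zero (x y : ℝ) (ψ : State) (m : ℤ) :
    walkOp x y ψ (m, 0) =
      x * ψ (m + 1, 0) + y * ψ (m + 1, 1) + (-1 - x - y) * ψ (m + 1, 2) := by
  rw [evolution_apply, Fin.sum_univ_three]
  simp [toComplex, coin, disp]

theorem walkOp_apply_one (x y : ℝ) (ψ : State) (m : ℤ) :
    walkOp x y ψ (m, 1) = (-1 - x - y) * ψ (m, 0) + x * ψ (m, 1) + y * ψ (m, 2) := by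
  rw [evolution_apply, Fin.sum_univ_three]
  simp [toComplex, coin, disp]

theorem walkOp_apply_two (x y : ℝ) (ψ : State) (m : ℤ) :
    walkOp x y ψ (m, 2) =
      y * ψ (m - 1, 0) + (-1 - x - y) * ψ (m - 1, 1) + x * ψ (m - 1, 2) := by
  rw [evolution_apply, Fin.sum_univ_three]
  simp [toComplex, coin, disp]

/-- Half the operator `(1 + x) + x (T + T⁻¹)`, which is `U + U⁻¹` off the eigenspace of `-1`. -/
def halfTrace (x : ℝ) : Module.End ℂ State :=
  ((1 + x : ℂ) / 2) • 1 + ((x : ℂ) / 2) • (translate 1 + translate (-1))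

theorem halfTrace_apply (x : ℝ) (ψ : State) (m : ℤ) (l : Fin 3) :
    halfTrace x ψ (m, l) =
      (1 + x) / 2 * ψ (m, l) + x / 2 * (ψ (m - 1, l) + ψ (m + 1, l)) := by
  have : halfTrace x ψ (m, l) =
      (1 + x) / 2 * ψ (m, l) + x / 2 * (ψ (m - 1, l) + ψ (m - -1, l)) := rfl
  rw [this, sub_neg_eq_add]

theorem state_add_apply (ψ χ : State) (p : ℤ × Fin 3) : (ψ + χ) p = ψ p + χ p := rfl

theorem state_sub_apply (ψ χ : State) (p : ℤ × Fin 3) : (ψ - χ) p = ψ p - χ p := rfl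

theorem state_smul_apply (c : ℂ) (ψ : State) (p : ℤ × Fin 3) : (c • ψ) p = c * ψ p := rfl

/-- The Cayley–Hamilton identity for the walk, with the factor `U + 1` split off. -/
theorem walkOp_recurrence {x y : ℝ} (h : x ^ 2 + y ^ 2 + x + y + x * y = 0) (η : State) :
    walkOp x y (walkOp x y (walkOp x y η + η)) =
      (2 : ℂ) • halfTrace x (walkOp x y (walkOp x y η + η)) - (walkOp x y η + η) := by
  have hc : (x : ℂ) ^ 2 + y ^ 2 + x + y + x * y = 0 := by exact_mod_cast h
  ext ⟨m, l⟩
  -- The two sides differ by a multiple of the curve equation; this cofactor serves all three coin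
  -- labels.
  have q : (walkOp x y η (m, l) + walkOp x y η (m + 1, l) + walkOp x y η (m - 1, l) +
      3 * η (m, l)) * ((x : ℂ) ^ 2 + y ^ 2 + x + y + x * y) = 0 := by rw [hc, mul_zero]
  rw [state_sub_apply, state_smul_apply, halfTrace_apply, state_add_apply]
  fin_cases l <;>
  · simp only [Fin.zero_eta, Fin.mk_one, Fin.reduceFinMk, map_add, state_add_apply,
      walkOp_apply_zero, walkOp_apply_one, walkOp_apply_two, add_sub_cancel_right,
      sub_add_cancel] at q ⊢
    linear_combination -q

theorem translate_basisState (d m : ℤ) (l : Fin 3) :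
    translate d (basisState (m, l)) = basisState (m + d, l) := by
  ext ⟨n, j⟩
  rw [translate_apply]
  simp only [lp.single_apply, Pi.single_apply, Prod.mk.injEq, sub_eq_iff_eq_add]

theorem evolution_translate (C : Matrix (Fin 3) (Fin 3) ℂ) (d : ℤ) (ψ : State) :
    evolution C (translate d ψ) = translate d (evolution C ψ) := by
  ext ⟨m, l⟩
  simp only [translate_apply, evolution_apply, sub_right_comm]

/-- The powers of `U` on the range of `U + 1` are Chebyshev polynomials in `halfTrace`. -/
theorem walkOp_pow_eq_chebyshev {x y : ℝ} (h : x ^ 2 + y ^ 2 + x + y + x * y = 0) (η : State)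
    (n : ℕ) :
    (walkOp x y ^ n) (walkOp x y η + η) =
      aeval (halfTrace x) (Chebyshev.U ℂ (n - 1)) (walkOp x y (walkOp x y η + η)) -
        aeval (halfTrace x) (Chebyshev.U ℂ (n - 2)) (walkOp x y η + η) := by
  induction n using Nat.twoStepInduction with
  | zero => simp
  | one => simp
  | more n ih1 ih2 =>
    have hrec : (walkOp x y ^ (n + 2)) (walkOp x y η + η) =
        (2 : ℂ) • halfTrace x ((walkOp x y ^ (n + 1)) (walkOp x y η + η)) -
          (walkOp x y ^ n) (walkOp x y η + η) := by
      have := walkOp_recurrence h ((walkOp x y ^ n) η)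
      have hcomm : ∀ ψ : State, walkOp x y ((walkOp x y ^ n) ψ) = (walkOp x y ^ n) (walkOp x y ψ) := by
        intro ψ
        rw [← Module.End.mul_apply, ← Module.End.mul_apply, ← pow_succ', pow_succ]
      rw [hcomm, ← map_add, hcomm, hcomm] at this
      simpa only [pow_add, pow_one, pow_two, Module.End.mul_apply] using this
    rw [hrec, ih2, ih1]
    have e1 : ((n + 2 : ℕ) : ℤ) - 1 = (n - 1) + 2 := by push_cast; ring
    have e2 : ((n + 2 : ℕ) : ℤ) - 2 = (n - 2) + 2 := by push_cast; ring
    have e3 : ((n + 1 : ℕ) : ℤ) - 1 = (n - 1) + 1 := by push_cast; ring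
    have e4 : ((n + 1 : ℕ) : ℤ) - 2 = (n - 2) + 1 := by push_cast; ring
    rw [e1, e2, e3, e4, Chebyshev.U_add_two, Chebyshev.U_add_two]
    simp only [map_sub, map_mul, aeval_X, map_ofNat, LinearMap.sub_apply, Module.End.mul_apply,
      Module.End.ofNat_apply]
    simp only [← Nat.cast_smul_eq_nsmul ℂ, Nat.cast_ofNat, smul_sub]
    abel

/-! ### Fourier integrals of Chebyshev polynomials -/

/-- The symbol of `halfTrace`. -/
def symbol (x k : ℝ) : ℝ := (1 + x) / 2 + x * Real.cos k

/-- The extreme values are (1+3x)/2 and (1-x)/2; the first is at most 1 exactly when x ≤ 1/3. -/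
theorem abs_symbol_le_one {x : ℝ} (h1 : -1 ≤ x) (h2 : x ≤ 1 / 3) (k : ℝ) : |symbol x k| ≤ 1 := by
  have := Real.neg_one_le_cos k
  have := Real.cos_le_one k
  rw [symbol, abs_le]
  constructor <;> nlinarith

/-- The Fourier integral `∫ e^{irk} f(symbol x k) dk` over a period. -/
def symbolIntegral (x : ℝ) (f : ℂ[X]) (r : ℤ) : ℂ :=
  ∫ k in (0 : ℝ)..(2 * Real.pi), exp (r * I * k) * f.eval (symbol x k : ℂ)

theorem continuous_symbol (x : ℝ) : Continuous (symbol x) := by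
  unfold symbol; fun_prop

theorem continuous_symbolIntegrand (x : ℝ) (f : ℂ[X]) (r : ℤ) :
    Continuous fun k : ℝ => exp (r * I * k) * f.eval (symbol x k : ℂ) := by
  have := continuous_symbol x
  have : Continuous fun k : ℝ => f.eval (symbol x k : ℂ) := f.continuous.comp (by fun_prop)
  fun_prop

theorem intervalIntegrable_symbolIntegrand (x : ℝ) (f : ℂ[X]) (r : ℤ) (a b : ℝ) :
    IntervalIntegrable (fun k : ℝ => exp (r * I * k) * f.eval (symbol x k : ℂ))
      MeasureTheory.volume a b :=
  (continuous_symbolIntegrand x f r).intervalIntegrable a b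

theorem exp_int_mul_two_pi (r : ℤ) : exp (r * I * (2 * Real.pi : ℝ)) = 1 := by
  rw [Complex.exp_eq_one_iff]
  exact ⟨r, by push_cast; ring⟩

theorem symbolIntegral_C (x : ℝ) (a : ℂ) (r : ℤ) :
    symbolIntegral x (C a) r = if r = 0 then 2 * Real.pi * a else 0 := by
  simp only [symbolIntegral, eval_C, intervalIntegral.integral_mul_const]
  split_ifs with hr
  · simp [hr]
  · rw [integral_exp_mul_complex (by simp [hr]), exp_int_mul_two_pi]
    simp

theorem symbolIntegral_add (x : ℝ) (f g : ℂ[X]) (r : ℤ) :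
    symbolIntegral x (f + g) r = symbolIntegral x f r + symbolIntegral x g r := by
  unfold symbolIntegral
  rw [← intervalIntegral.integral_add (intervalIntegrable_symbolIntegrand ..)
    (intervalIntegrable_symbolIntegrand ..)]
  simp only [eval_add, mul_add]

theorem symbolIntegral_X_mul (x : ℝ) (f : ℂ[X]) (r : ℤ) :
    symbolIntegral x (X * f) r = (1 + x) / 2 * symbolIntegral x f r +
      x / 2 * (symbolIntegral x f (r - 1) + symbolIntegral x f (r + 1)) := by
  unfold symbolIntegral
  rw [← intervalIntegral.integral_add (intervalIntegrable_symbolIntegrand ..)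
    (intervalIntegrable_symbolIntegrand ..), ← intervalIntegral.integral_const_mul,
    ← intervalIntegral.integral_const_mul, ← intervalIntegral.integral_add
    ((intervalIntegrable_symbolIntegrand ..).const_mul _)
    (((intervalIntegrable_symbolIntegrand ..).add
      (intervalIntegrable_symbolIntegrand ..)).const_mul _)]
  refine intervalIntegral.integral_congr fun k _ => ?_
  have e1 : exp ((r - 1 : ℤ) * I * k) = exp (r * I * k) * exp (-k * I) := by
    rw [← Complex.exp_add]; congr 1; push_cast; ring
  have e2 : exp ((r + 1 : ℤ) * I * k) = exp (r * I * k) * exp (k * I) := by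
    rw [← Complex.exp_add]; congr 1; push_cast; ring
  have e3 : ((symbol x k : ℝ) : ℂ) = (1 + x) / 2 + x * ((exp (k * I) + exp (-k * I)) / 2) := by
    rw [symbol]; push_cast; rw [Complex.cos]
  simp only [eval_mul, eval_X, e1, e2]
  linear_combination (exp (r * I * k) * eval (symbol x k : ℂ) f) * e3

/-- `halfTrace_apply` and `symbolIntegral_X_mul` are the same three-term rule, so induction on the
degree matches the two sides. -/
theorem aeval_halfTrace_basisState (x : ℝ) (f : ℂ[X]) (n m : ℤ) (j l : Fin 3) :
    aeval (halfTrace x) f (basisState (n, j)) (m, l) =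
      if l = j then (2 * Real.pi : ℂ)⁻¹ * symbolIntegral x f (m - n) else 0 := by
  have hpi : (2 * Real.pi : ℂ) ≠ 0 := by simp [Real.pi_ne_zero]
  induction f using Polynomial.induction_on generalizing m with
  | C a =>
    rw [aeval_C, Module.algebraMap_end_apply, state_smul_apply, symbolIntegral_C,
      lp.single_apply, Pi.single_apply]
    by_cases h1 : l = j <;> by_cases h2 : m = n <;> simp [h1, h2, sub_eq_zero]
    field_simp
  | add f g hf hg =>
    rw [map_add, LinearMap.add_apply, state_add_apply, hf, hg, symbolIntegral_add]
    split_ifs <;> ring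
  | monomial d a ih =>
    have : C a * X ^ (d + 1) = X * (C a * X ^ d) := by ring
    rw [this, map_mul, aeval_X, Module.End.mul_apply, halfTrace_apply, ih, ih, ih,
      symbolIntegral_X_mul, sub_right_comm, sub_add_eq_add_sub]
    split_ifs <;> ring

theorem hasDerivAt_symbol (x k : ℝ) :
    HasDerivAt (fun k : ℝ => (symbol x k : ℂ)) (-(x * Real.sin k : ℝ)) k := by
  have : HasDerivAt (symbol x) (-(x * Real.sin k)) k := by
    unfold symbol
    simpa using ((Real.hasDerivAt_cos k).const_mul x).const_add ((1 + x) / 2)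
  exact_mod_cast this.ofReal_comp

/-- Integration by parts for the Fourier coefficients of `Tₙ(symbol)`. -/
theorem symbolIntegral_T (x : ℝ) (r n : ℤ) :
    2 * r * symbolIntegral x (Chebyshev.T ℂ n) r = x * n *
      (symbolIntegral x (Chebyshev.U ℂ (n - 1)) (r - 1) -
        symbolIntegral x (Chebyshev.U ℂ (n - 1)) (r + 1)) := by
  set T := Chebyshev.T ℂ n
  set V := Chebyshev.U ℂ (n - 1)
  -- T_n' = n U_{n-1}, and the sin k from the chain rule is a difference of exponentials, which
  -- shifts the frequency r by ±1.
  have hder : ∀ k : ℝ, HasDerivAt (fun k : ℝ => exp (r * I * k) * T.eval (symbol x k : ℂ))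
      (r * I * (exp (r * I * k) * T.eval (symbol x k : ℂ)) + x * n * I / 2 *
        (exp ((r + 1 : ℤ) * I * k) * V.eval (symbol x k : ℂ) -
          exp ((r - 1 : ℤ) * I * k) * V.eval (symbol x k : ℂ))) k := by
    intro k
    have d1 : HasDerivAt (fun k : ℝ => exp (r * I * k)) (exp (r * I * k) * (r * I)) k := by
      have : HasDerivAt (fun k : ℝ => (r * I * k : ℂ)) (r * I) k := by
        simpa using (hasDerivAt_id k).ofReal_comp.const_mul (r * I : ℂ)
      exact this.cexp
    have d2 := (T.hasDerivAt (symbol x k : ℂ)).comp k (hasDerivAt_symbol x k)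
    refine (d1.mul d2).congr_deriv ?_
    have e1 : exp ((r - 1 : ℤ) * I * k) = exp (r * I * k) * exp (-k * I) := by
      rw [← Complex.exp_add]; congr 1; push_cast; ring
    have e2 : exp ((r + 1 : ℤ) * I * k) = exp (r * I * k) * exp (k * I) := by
      rw [← Complex.exp_add]; congr 1; push_cast; ring
    have e3 : ((Real.sin k : ℝ) : ℂ) = (exp (-k * I) - exp (k * I)) * I / 2 := by
      push_cast; rw [Complex.sin]
    have e4 : (derivative T).eval (symbol x k : ℂ) = n * V.eval (symbol x k : ℂ) := by
      rw [Chebyshev.T_derivative_eq_U, eval_mul, eval_intCast]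
    rw [e4, e1, e2, ofReal_mul, e3]
    simp only [Function.comp_apply]
    ring
  have hint := intervalIntegral.integral_eq_sub_of_hasDerivAt (a := 0) (b := 2 * Real.pi)
    (fun k _ => hder k)
    (((intervalIntegrable_symbolIntegrand ..).const_mul _).add
      (((intervalIntegrable_symbolIntegrand ..).sub
        (intervalIntegrable_symbolIntegrand ..)).const_mul _))
  rw [intervalIntegral.integral_add ((intervalIntegrable_symbolIntegrand ..).const_mul _)
      (((intervalIntegrable_symbolIntegrand ..).sub
        (intervalIntegrable_symbolIntegrand ..)).const_mul _),
    intervalIntegral.integral_const_mul, intervalIntegral.integral_const_mul,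
    intervalIntegral.integral_sub (intervalIntegrable_symbolIntegrand ..)
      (intervalIntegrable_symbolIntegrand ..), exp_int_mul_two_pi] at hint
  have hper : symbol x (2 * Real.pi) = symbol x 0 := by simp [symbol]
  rw [hper, ofReal_zero, mul_zero, Complex.exp_zero, sub_self] at hint
  have hI : I * (2 * r * symbolIntegral x T r) = I * (x * n *
      (symbolIntegral x V (r - 1) - symbolIntegral x V (r + 1))) := by
    unfold symbolIntegral
    linear_combination 2 * hint
  exact mul_left_cancel₀ I_ne_zero hI

theorem norm_symbolIntegral_T_le {x : ℝ} (h1 : -1 ≤ x) (h2 : x ≤ 1 / 3) (r n : ℤ) :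
    ‖symbolIntegral x (Chebyshev.T ℂ n) r‖ ≤ 2 * Real.pi := by
  have := intervalIntegral.norm_integral_le_of_norm_le_const (a := 0) (b := 2 * Real.pi) (C := 1)
    (f := fun k : ℝ => exp (r * I * k) * (Chebyshev.T ℂ n).eval (symbol x k : ℂ)) (fun k _ => by
      have e : (r * I * k : ℂ) = (r * k : ℝ) * I := by push_cast; ring
      rw [norm_mul, e, Complex.norm_exp_ofReal_mul_I, one_mul, ← Chebyshev.complex_ofReal_eval_T,
        Complex.norm_real, Real.norm_eq_abs]
      exact Chebyshev.abs_eval_T_real_le_one n (abs_symbol_le_one h1 h2 k))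
  rwa [one_mul, sub_zero, abs_of_pos Real.two_pi_pos] at this

/-- By `symbolIntegral_T` the difference is at most 4π|r| / (|x| n). -/
theorem tendsto_symbolIntegral_U_sub {x : ℝ} (h1 : -1 ≤ x) (h2 : x ≤ 1 / 3) (hx : x ≠ 0) (r : ℤ) :
    Tendsto (fun n : ℕ => symbolIntegral x (Chebyshev.U ℂ (n - 1)) (r - 1) -
      symbolIntegral x (Chebyshev.U ℂ (n - 1)) (r + 1)) atTop (𝓝 0) := by
  have hlim : Tendsto (fun n : ℕ => (2 * |(r : ℝ)| * (2 * Real.pi) / |x|) / (n : ℝ)) atTop (𝓝 0) :=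
    tendsto_const_div_atTop_nhds_zero_nat _
  refine squeeze_zero_norm' ?_ hlim
  filter_upwards [eventually_gt_atTop 0] with n hn
  have hn' : (0 : ℝ) < n := by exact_mod_cast hn
  have e := congrArg norm (symbolIntegral_T x r n)
  have hT := norm_symbolIntegral_T_le h1 h2 r n
  simp only [norm_mul, Complex.norm_real, Real.norm_eq_abs, Complex.norm_intCast, Complex.norm_two,
    Int.cast_natCast, Complex.norm_natCast] at e
  rw [div_div, le_div_iff₀ (by positivity), mul_comm, ← e]
  gcongr

/-! ### Decaying states -/

/-- The states all of whose amplitudes tend to zero under the walk. -/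
def decaying (x y : ℝ) : Submodule ℂ State where
  carrier := {ψ | ∀ p, Tendsto (fun t : ℕ => (walkOp x y ^ t) ψ p) atTop (𝓝 0)}
  add_mem' {a b} ha hb p := by
    simpa [state_add_apply] using (ha p).add (hb p)
  zero_mem' p := by simp
  smul_mem' c a ha p := by
    simpa [state_smul_apply] using (ha p).const_mul c

theorem walkOp_basisState_mem_span (x y : ℝ) (q : ℤ × Fin 3) :
    walkOp x y (basisState q) ∈ Submodule.span ℂ (Set.range basisState) := by
  have : walkOp x y (basisState q) =
      ∑ l, toComplex (coin x y) l q.2 • basisState (q.1 + disp l, l) := by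
    ext ⟨m, l⟩
    rw [evolution_apply, lp.coeFn_sum, Finset.sum_apply]
    simp only [state_smul_apply, lp.single_apply, Pi.single_apply, Prod.ext_iff]
    rw [Finset.sum_eq_single q.2, Finset.sum_eq_single l]
    · simp [sub_eq_iff_eq_add]
    · intro b _ hb; simp [hb.symm]
    · simp
    · intro b _ hb; simp [hb]
    · simp
  rw [this]
  exact Submodule.sum_mem _ fun l _ =>
    Submodule.smul_mem _ _ (Submodule.subset_span (Set.mem_range_self _))

theorem walkOp_mem_span (x y : ℝ) {ψ : State}
    (hψ : ψ ∈ Submodule.span ℂ (Set.range basisState)) :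
    walkOp x y ψ ∈ Submodule.span ℂ (Set.range basisState) := by
  have : Submodule.span ℂ (Set.range basisState) ≤
      (Submodule.span ℂ (Set.range basisState)).comap (walkOp x y) := by
    rw [Submodule.span_le]
    rintro _ ⟨q, rfl⟩
    exact walkOp_basisState_mem_span x y q
  exact this hψ

/-- The difference of translations supplies the factor sin k that integration by parts needs. -/
theorem tendsto_aeval_U_of_mem_span {x : ℝ} (h1 : -1 ≤ x) (h2 : x ≤ 1 / 3) (hx : x ≠ 0)
    {ψ : State} (hψ : ψ ∈ Submodule.span ℂ (Set.range basisState)) (p : ℤ × Fin 3) :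
    Tendsto (fun n : ℕ => aeval (halfTrace x) (Chebyshev.U ℂ (n - 1))
      (translate 1 ψ - translate (-1) ψ) p) atTop (𝓝 0) := by
  induction hψ using Submodule.span_induction with
  | mem ψ h =>
    obtain ⟨⟨n, j⟩, rfl⟩ := h
    obtain ⟨m, l⟩ := p
    simp only [translate_basisState, map_sub, state_sub_apply, aeval_halfTrace_basisState]
    split_ifs with hl
    · have := (tendsto_symbolIntegral_U_sub h1 h2 hx (m - n)).const_mul (2 * Real.pi : ℂ)⁻¹
      rw [mul_zero] at this
      refine this.congr fun t => ?_
      rw [mul_sub]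
      congr 3 <;> ring
    · simp
  | zero => simp
  | add a b _ _ ha hb =>
    have := ha.add hb
    rw [add_zero] at this
    refine this.congr fun t => ?_
    simp only [map_add, map_sub, state_add_apply, state_sub_apply]
    ring
  | smul c a _ ha =>
    have := ha.const_mul c
    rw [mul_zero] at this
    refine this.congr fun t => ?_
    simp only [map_smul, map_sub, state_smul_apply, state_sub_apply]
    ring

/-- U commutes with translations, so the Chebyshev formula and `tendsto_aeval_U_of_mem_span` both
apply. The outer U + 1 is kept visible so that it can later be moved to its adjoint. -/
theorem walkOp_add_self_mem_decaying {x y : ℝ} (h : x ^ 2 + y ^ 2 + x + y + x * y = 0)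
    (h1 : -1 ≤ x) (h2 : x ≤ 1 / 3) (hx : x ≠ 0) (q : ℤ × Fin 3) :
    walkOp x y (translate 1 (basisState q) - translate (-1) (basisState q)) +
      (translate 1 (basisState q) - translate (-1) (basisState q)) ∈ decaying x y := by
  intro p
  set η := basisState q
  set χ := walkOp x y η + η with hχ
  have hη : η ∈ Submodule.span ℂ (Set.range basisState) :=
    Submodule.subset_span (Set.mem_range_self q)
  have hχs : χ ∈ Submodule.span ℂ (Set.range basisState) :=
    Submodule.add_mem _ (walkOp_mem_span x y hη) hη
  have e0 : walkOp x y (translate 1 η - translate (-1) η) + (translate 1 η - translate (-1) η) =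
      translate 1 χ - translate (-1) χ := by
    rw [hχ, map_sub, evolution_translate, evolution_translate, map_add, map_add]
    abel
  have e1 : walkOp x y (translate 1 χ - translate (-1) χ) =
      translate 1 (walkOp x y χ) - translate (-1) (walkOp x y χ) := by
    rw [map_sub, evolution_translate, evolution_translate]
  -- At time n + 1 the Chebyshev indices are n and n - 1, both covered by the previous limit.
  rw [← tendsto_add_atTop_iff_nat 1]
  have l1 := (tendsto_add_atTop_iff_nat 1).2
    (tendsto_aeval_U_of_mem_span h1 h2 hx (walkOp_mem_span x y hχs) p)
  have l2 := tendsto_aeval_U_of_mem_span h1 h2 hx hχs p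
  have l3 := l1.sub l2
  rw [sub_zero] at l3
  refine l3.congr fun n => ?_
  rw [walkOp_pow_eq_chebyshev h, state_sub_apply, e0, e1]
  have : ((n + 1 : ℕ) : ℤ) - 2 = n - 1 := by push_cast; ring
  rw [this]

/-! ### Isometry of the walk -/

theorem norm_sq_eq_tsum (ψ : State) : ‖ψ‖ ^ 2 = ∑' p, ‖ψ p‖ ^ 2 := by
  have := lp.norm_rpow_eq_tsum (p := 2) (by norm_num) ψ
  simpa using this

theorem summable_norm_sq (ψ : State) : Summable fun p => ‖ψ p‖ ^ 2 := by
  have := (lp.hasSum_norm (p := 2) (by norm_num) ψ).summable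
  simpa using this

/-- The bijection of the index set that underlies the conditional shift. -/
def shiftEquiv : ℤ × Fin 3 ≃ ℤ × Fin 3 where
  toFun p := (p.1 - disp p.2, p.2)
  invFun p := (p.1 + disp p.2, p.2)
  left_inv p := by simp
  right_inv p := by simp

theorem norm_shift (ψ : State) : ‖shift ψ‖ = ‖ψ‖ := by
  rw [← sq_eq_sq₀ (norm_nonneg _) (norm_nonneg _), norm_sq_eq_tsum, norm_sq_eq_tsum,
    ← shiftEquiv.tsum_eq fun p => ‖ψ p‖ ^ 2]
  rfl

theorem norm_sq_coin_apply {x y : ℝ} (h : x ^ 2 + y ^ 2 + x + y + x * y = 0) (v : Fin 3 → ℂ) :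
    ∑ l, ‖∑ j, toComplex (coin x y) l j * v j‖ ^ 2 = ∑ l, ‖v l‖ ^ 2 := by
  have hre : ∀ l, (∑ j, toComplex (coin x y) l j * v j).re = ∑ j, coin x y l j * (v j).re := by
    intro l; simp [toComplex]
  have him : ∀ l, (∑ j, toComplex (coin x y) l j * v j).im = ∑ j, coin x y l j * (v j).im := by
    intro l; simp [toComplex]
  simp only [Complex.sq_norm, Complex.normSq_apply, hre, him]
  simp only [Fin.sum_univ_three, coin, Matrix.of_apply, Matrix.cons_val]
  generalize v 0 = a, v 1 = b, v 2 = c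
  have q : ∀ a b c : ℝ, (x * a + y * b + (-1 - x - y) * c) ^ 2 +
      ((-1 - x - y) * a + x * b + y * c) ^ 2 + (y * a + (-1 - x - y) * b + x * c) ^ 2 =
      a ^ 2 + b ^ 2 + c ^ 2 := by
    intro a b c
    -- With Q the curve polynomial, each column has squared norm 1 + 2Q and distinct columns have
    -- product -Q.
    linear_combination (2 * (a ^ 2 + b ^ 2 + c ^ 2) - 2 * (a * b + b * c + c * a)) * h
  linear_combination q a.re b.re c.re + q a.im b.im c.im

theorem norm_coinOp {x y : ℝ} (h : x ^ 2 + y ^ 2 + x + y + x * y = 0) (ψ : State) :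
    ‖coinOp (toComplex (coin x y)) ψ‖ = ‖ψ‖ := by
  rw [← sq_eq_sq₀ (norm_nonneg _) (norm_nonneg _), norm_sq_eq_tsum, norm_sq_eq_tsum,
    (summable_norm_sq _).tsum_prod, (summable_norm_sq _).tsum_prod]
  refine tsum_congr fun m => ?_
  rw [tsum_fintype, tsum_fintype]
  exact norm_sq_coin_apply h fun j => ψ (m, j)

theorem norm_walkOp {x y : ℝ} (h : x ^ 2 + y ^ 2 + x + y + x * y = 0) (ψ : State) :
    ‖walkOp x y ψ‖ = ‖ψ‖ :=
  (norm_shift _).trans (norm_coinOp h ψ)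

/-- The walk as a linear isometry. -/
def walkIsometry {x y : ℝ} (h : x ^ 2 + y ^ 2 + x + y + x * y = 0) : State →ₗᵢ[ℂ] State :=
  ⟨walkOp x y, norm_walkOp h⟩

theorem norm_walkOp_pow {x y : ℝ} (h : x ^ 2 + y ^ 2 + x + y + x * y = 0) (n : ℕ) (ψ : State) :
    ‖(walkOp x y ^ n) ψ‖ = ‖ψ‖ := by
  induction n with
  | zero => simp
  | succ n ih => rw [pow_succ', Module.End.mul_apply, norm_walkOp h, ih]

/-- All powers of U preserve the norm, so approximation in norm controls each amplitude uniformly in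
time. -/
theorem isClosed_decaying {x y : ℝ} (h : x ^ 2 + y ^ 2 + x + y + x * y = 0) :
    IsClosed (decaying x y : Set State) := by
  refine isClosed_of_closure_subset fun ψ hψ p => ?_
  rw [Metric.tendsto_atTop]
  intro ε hε
  obtain ⟨χ, hχ, hd⟩ := Metric.mem_closure_iff.1 hψ (ε / 2) (half_pos hε)
  obtain ⟨N, hN⟩ := Metric.tendsto_atTop.1 (hχ p) (ε / 2) (half_pos hε)
  refine ⟨N, fun n hn => ?_⟩
  have e : (walkOp x y ^ n) ψ p = (walkOp x y ^ n) χ p + (walkOp x y ^ n) (ψ - χ) p := by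
    rw [map_sub, state_sub_apply]; ring
  have b1 := hN n hn
  have b2 := lp.norm_apply_le_norm two_ne_zero ((walkOp x y ^ n) (ψ - χ)) p
  rw [norm_walkOp_pow h, ← dist_eq_norm] at b2
  rw [dist_zero_right] at b1 ⊢
  rw [e]
  linarith [norm_add_le ((walkOp x y ^ n) χ p) ((walkOp x y ^ n) (ψ - χ) p)]

/-! ### The orthogonal complement of the decaying states -/

theorem eq_zero_of_periodic (ζ : State) (hζ : ∀ m l, ζ (m + 1, l) = ζ (m - 1, l)) : ζ = 0 := by
  ext ⟨m, l⟩
  have hper : ∀ n : ℕ, ζ (m + 2 * n, l) = ζ (m, l) := by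
    intro n
    induction n with
    | zero => simp
    | succ n ih =>
      rw [← ih]
      convert hζ (m + 2 * n + 1) l using 3 <;> push_cast <;> ring
  have hs : Summable fun n : ℕ => ‖ζ (m + 2 * n, l)‖ ^ 2 :=
    (summable_norm_sq ζ).comp_injective (i := fun n : ℕ => (m + 2 * (n : ℤ), l)) fun a b hab => by
      have := (Prod.mk.inj hab).1
      omega
  have h0 := hs.tendsto_atTop_zero
  simp only [hper] at h0
  have := tendsto_nhds_unique h0 tendsto_const_nhds
  simpa using this.symm

/-- Orthogonality to `walkOp_add_self_mem_decaying` makes (U + 1)*ξ 2-periodic in the site, hence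
zero in ℓ². Then ⟨ξ, Uξ⟩ = -‖ξ‖², and isometry gives ‖Uξ + ξ‖² = 0. -/
theorem walkOp_eq_neg_of_mem_orthogonal {x y : ℝ} (h : x ^ 2 + y ^ 2 + x + y + x * y = 0)
    (h1 : -1 ≤ x) (h2 : x ≤ 1 / 3) (hx : x ≠ 0) {ξ : State} (hξ : ξ ∈ (decaying x y)ᗮ) :
    walkOp x y ξ = -ξ := by
  let A : State →L[ℂ] State := (walkIsometry h).toContinuousLinearMap + 1
  have hA : ∀ η, A η = walkOp x y η + η := fun _ => rfl
  have hζ : A.adjoint ξ = 0 := by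
    refine eq_zero_of_periodic _ fun m l => ?_
    have := Submodule.mem_orthogonal' _ _ |>.1 hξ _
      (walkOp_add_self_mem_decaying h h1 h2 hx (m, l))
    rw [← hA, ← ContinuousLinearMap.adjoint_inner_left, translate_basisState, translate_basisState,
      inner_sub_right, lp.inner_single_right, lp.inner_single_right, sub_eq_zero] at this
    exact (starRingEnd ℂ).injective (by simpa [← sub_eq_add_neg] using this)
  have hin : inner ℂ ξ (walkOp x y ξ) = -inner ℂ ξ ξ := by
    have : inner ℂ ξ (A ξ) = 0 := by
      rw [← ContinuousLinearMap.adjoint_inner_left, hζ, inner_zero_left]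
    rw [hA, inner_add_right] at this
    exact eq_neg_of_add_eq_zero_left this
  rw [← add_eq_zero_iff_eq_neg, ← norm_eq_zero, ← sq_eq_zero_iff, @norm_add_sq ℂ, ← inner_conj_symm,
    RCLike.conj_re, hin, norm_walkOp h, map_neg, inner_self_eq_norm_sq]
  ring

/-! ### The initial state and the bound states -/

theorem inner_initial_right (ξ : State) (φ : EuclideanSpace ℂ (Fin 3)) :
    inner ℂ ξ (initial φ) = ∑ l, φ l * star (ξ (0, l)) := by
  rw [initial, inner_sum]
  simp [lp.inner_single_right]

theorem initial_apply (φ : EuclideanSpace ℂ (Fin 3)) (m : ℤ) (l : Fin 3) :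
    initial φ (m, l) = if m = 0 then φ l else 0 := by
  rw [initial, lp.coeFn_sum, Finset.sum_apply]
  simp only [lp.single_apply, Pi.single_apply, Prod.mk.injEq]
  by_cases hm : m = 0 <;> simp [hm]

/-- An eigenvector of the walk for the eigenvalue `-1`, supported on the sites `m` and `m + 1`. -/
def boundState (x y : ℝ) (m : ℤ) : State :=
  ((1 + x : ℂ)) • basisState (m, 0) + ((1 + x + y : ℂ)) • basisState (m, 1) +
    (-(y : ℂ)) • basisState (m + 1, 1) + ((1 + x : ℂ)) • basisState (m + 1, 2)

theorem walkOp_boundState {x y : ℝ} (h : x ^ 2 + y ^ 2 + x + y + x * y = 0) (m : ℤ) :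
    walkOp x y (boundState x y m) = -boundState x y m := by
  have hc : (x : ℂ) ^ 2 + y ^ 2 + x + y + x * y = 0 := by exact_mod_cast h
  ext ⟨n, l⟩
  have hneg : (-boundState x y m) (n, l) = -(boundState x y m (n, l)) := rfl
  rw [hneg]
  have val : ∀ n l, boundState x y m (n, l) =
      (if n = m then ![(1 + x : ℂ), 1 + x + y, 0] l else 0) +
      (if n = m + 1 then ![(0 : ℂ), -y, 1 + x] l else 0) := by
    intro n l
    simp only [boundState, state_add_apply, state_smul_apply, lp.single_apply, Pi.single_apply,
      Prod.mk.injEq]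
    fin_cases l <;> by_cases hn : n = m <;> by_cases hn' : n = m + 1 <;> simp [hn, hn']
  fin_cases l
  · simp only [Fin.zero_eta, walkOp_apply_zero, val, Matrix.cons_val]
    split_ifs
    all_goals first | omega | linear_combination hc | linear_combination -hc | ring
  · simp only [Fin.mk_one, walkOp_apply_one, val, Matrix.cons_val]
    split_ifs
    all_goals first | omega | ring
  · simp only [Fin.reduceFinMk, walkOp_apply_two, val, Matrix.cons_val]
    split_ifs
    all_goals first | omega | linear_combination hc | linear_combination -hc | ring

theorem boundState_mem_span (x y : ℝ) (m : ℤ) :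
    boundState x y m ∈ Submodule.span ℂ (Set.range basisState) := by
  have : ∀ p, basisState p ∈ Submodule.span ℂ (Set.range basisState) := fun p =>
    Submodule.subset_span (Set.mem_range_self p)
  unfold boundState
  exact Submodule.add_mem _ (Submodule.add_mem _ (Submodule.add_mem _
    (Submodule.smul_mem _ _ (this _)) (Submodule.smul_mem _ _ (this _)))
    (Submodule.smul_mem _ _ (this _))) (Submodule.smul_mem _ _ (this _))

/-- Finitely supported eigenvectors are orthogonal to the decaying states. -/
theorem inner_eq_zero_of_mem_decaying {x y : ℝ} (h : x ^ 2 + y ^ 2 + x + y + x * y = 0)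
    {ξ ψ : State} (hξ : ξ ∈ Submodule.span ℂ (Set.range basisState))
    (hU : walkOp x y ξ = -ξ) (hψ : ψ ∈ decaying x y) : inner ℂ ξ ψ = 0 := by
  -- Finite support of ξ makes the pairing tend to zero, while its modulus is constant in t.
  have hlim : Tendsto (fun t : ℕ => inner ℂ ξ ((walkOp x y ^ t) ψ)) atTop (𝓝 0) := by
    clear hU
    induction hξ using Submodule.span_induction with
    | mem ξ h =>
      obtain ⟨q, rfl⟩ := h
      simpa [lp.inner_single_left] using hψ q
    | zero => simp
    | add a b _ _ ha hb => simpa [inner_add_left] using ha.add hb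
    | smul c a _ ha => simpa [inner_smul_left, mul_comm] using ha.const_mul (starRingEnd ℂ c)
  have hnorm : ∀ t : ℕ, ‖inner ℂ ξ ((walkOp x y ^ t) ψ)‖ = ‖inner ℂ ξ ψ‖ := by
    intro t
    induction t with
    | zero => simp
    | succ t ih =>
      have := (walkIsometry h).inner_map_map ξ ((walkOp x y ^ t) ψ)
      change inner ℂ (walkOp x y ξ) (walkOp x y ((walkOp x y ^ t) ψ)) = _ at this
      rw [hU, inner_neg_left] at this
      rw [pow_succ', Module.End.mul_apply, ← ih, ← this, norm_neg]
  have h0 := hlim.norm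
  simp only [hnorm, norm_zero] at h0
  exact norm_eq_zero.1 (tendsto_nhds_unique tendsto_const_nhds h0)

/-- These are D and E: the bound states at 0 and -1 are the two that meet the origin. -/
theorem inner_boundState_initial (x y : ℝ) (φ : EuclideanSpace ℂ (Fin 3)) :
    inner ℂ (boundState x y 0) (initial φ) = φ 0 * (1 + x) + φ 1 * (1 + x + y) ∧
      inner ℂ (boundState x y (-1)) (initial φ) = φ 2 * (1 + x) - φ 1 * y := by
  simp only [boundState, inner_add_left, inner_smul_left, lp.inner_single_left, initial_apply]
  constructor <;> simp <;> ring

theorem walkOp_pow_of_eq_neg {x y : ℝ} {ξ : State} (hU : walkOp x y ξ = -ξ) (t : ℕ) :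
    (walkOp x y ^ t) ξ = ((-1 : ℂ) ^ t) • ξ := by
  induction t with
  | zero => simp
  | succ t ih => rw [pow_succ', Module.End.mul_apply, ih, map_smul, hU, pow_succ]; simp

/-! ### The limit of the return probability -/

theorem exists_limit_prob_zero {x y : ℝ} (h : x ^ 2 + y ^ 2 + x + y + x * y = 0)
    (h1 : -1 ≤ x) (h2 : x ≤ 1 / 3) (hx : x ≠ 0) (φ : EuclideanSpace ℂ (Fin 3)) :
    ∃ L : ℝ, Tendsto (fun t : ℕ => prob (toComplex (coin x y)) φ 0 t) atTop (𝓝 L) ∧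
      (L = 0 → initial φ ∈ decaying x y) ∧
      ((∀ ξ : State, walkOp x y ξ = -ξ → inner ℂ ξ (initial φ) = 0) → L = 0) := by
  have : CompleteSpace (decaying x y) := (isClosed_decaying h).completeSpace_coe
  obtain ⟨g, hg, ξ, hξ, hsum⟩ := (decaying x y).exists_add_mem_mem_orthogonal (initial φ)
  have hU := walkOp_eq_neg_of_mem_orthogonal h h1 h2 hx hξ
  have hself : inner ℂ ξ (initial φ) = inner ℂ ξ ξ := by
    rw [hsum, inner_add_right, Submodule.inner_left_of_mem_orthogonal hg hξ, zero_add]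
  refine ⟨∑ l, ‖ξ (0, l)‖ ^ 2, ?_, fun hL => ?_, fun hφ => ?_⟩
  · refine tendsto_finsetSum _ fun l _ => ?_
    have hdiff : Tendsto (fun t : ℕ => ‖(walkOp x y ^ t) g (0, l)‖) atTop (𝓝 0) := by
      simpa using (hg (0, l)).norm
    have hn : Tendsto (fun t : ℕ => ‖(walkOp x y ^ t) (initial φ) (0, l)‖) atTop
        (𝓝 ‖ξ (0, l)‖) := by
      rw [tendsto_iff_norm_sub_tendsto_zero]
      refine squeeze_zero (fun _ => norm_nonneg _) (fun t => ?_) hdiff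
      have e : (walkOp x y ^ t) (initial φ) (0, l) =
          (walkOp x y ^ t) g (0, l) + (-1) ^ t * ξ (0, l) := by
        rw [hsum, map_add, state_add_apply, walkOp_pow_of_eq_neg hU, state_smul_apply]
      -- The sign (-1)^t has modulus one, so the oscillation of ξ does not affect the probability.
      have e' : ‖ξ (0, l)‖ = ‖(-1) ^ t * ξ (0, l)‖ := by simp
      rw [e', Real.norm_eq_abs]
      refine (abs_norm_sub_norm_le _ _).trans_eq ?_
      rw [e, add_sub_cancel_right]
    exact hn.pow 2
  · have hz : ∀ l, ξ (0, l) = 0 := by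
      intro l
      have := (Finset.sum_eq_zero_iff_of_nonneg fun l _ => by positivity).1 hL l (Finset.mem_univ l)
      simpa using this
    -- ‖ξ‖² = ⟨ξ, initial φ⟩ involves only the amplitudes of ξ at the origin, which vanish.
    have : ξ = 0 := by
      rw [← inner_self_eq_zero (𝕜 := ℂ), ← hself, inner_initial_right]
      simp [hz]
    rwa [hsum, this, add_zero]
  · have : ξ = 0 := by
      rw [← inner_self_eq_zero (𝕜 := ℂ), ← hself, hφ ξ hU]
    simp [this]

/-- The middle coin label does not move, so the coordinate (0, 1) of Uξ = -ξ is a linear relation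
among the origin amplitudes alone. -/
theorem inner_initial_eq_zero_of_eq_neg {x y : ℝ} (hx1 : x ≠ -1) {φ : EuclideanSpace ℂ (Fin 3)}
    (hD : φ 0 * (1 + x) + φ 1 * (1 + x + y) = 0) (hE : φ 2 * (1 + x) - φ 1 * y = 0)
    {ξ : State} (hU : walkOp x y ξ = -ξ) : inner ℂ ξ (initial φ) = 0 := by
  have hx : (1 + x : ℂ) ≠ 0 := by
    intro h
    exact hx1 (by have : 1 + x = 0 := by exact_mod_cast h
                  linarith)
  have hm : walkOp x y ξ (0, 1) = -ξ (0, 1) := by rw [hU]; rfl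
  rw [walkOp_apply_one] at hm
  have hs := congrArg (starRingEnd ℂ) hm
  simp only [map_add, map_mul, map_sub, map_neg, map_one, conj_ofReal] at hs
  rw [inner_initial_right, Fin.sum_univ_three]
  simp only [RCLike.star_def]
  refine (mul_eq_zero.1 ?_).resolve_left hx
  linear_combination (starRingEnd ℂ (ξ (0, 0))) * hD + (starRingEnd ℂ (ξ (0, 2))) * hE + φ 1 * hs

/-! ### The exceptional state -/

theorem eq_smul_exceptionalState_iff {x y : ℝ} (hx1 : x ≠ -1) {φ : EuclideanSpace ℂ (Fin 3)}
    (hφ : ‖φ‖ = 1) :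
    (∃ c : ℂ, ‖c‖ = 1 ∧ φ = c • exceptionalState x y) ↔
      φ 0 * (1 + x) + φ 1 * (1 + x + y) = 0 ∧ φ 2 * (1 + x) - φ 1 * y = 0 := by
  have hxr : 1 + x ≠ 0 := fun h => hx1 (by linarith)
  have hx : (1 + x : ℂ) ≠ 0 := by exact_mod_cast hxr
  have hN : 0 < √((1 + x + y) ^ 2 + (1 + x) ^ 2 + y ^ 2) := Real.sqrt_pos.2 (by positivity)
  unfold exceptionalState
  set N := √((1 + x + y) ^ 2 + (1 + x) ^ 2 + y ^ 2)
  have hNc : (N : ℂ) ≠ 0 := by exact_mod_cast hN.ne'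
  constructor
  · rintro ⟨c, -, rfl⟩
    constructor <;> simp <;> ring
  · rintro ⟨hD, hE⟩
    -- The scalar is forced by the middle component; it has modulus one since both vectors are unit.
    have heq : φ = (N * φ 1 / (1 + x) : ℂ) •
        (((1 / N : ℝ) : ℂ) • !₂[-(1 + (x : ℂ) + (y : ℂ)), 1 + (x : ℂ), (y : ℂ)]) := by
      ext l
      fin_cases l
      · simp
        field_simp
        linear_combination hD
      · simp
        field_simp
      · simp
        field_simp
        linear_combination hE
    refine ⟨_, ?_, heq⟩
    have hunit : ‖(((1 / N : ℝ) : ℂ) •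
        !₂[-(1 + (x : ℂ) + (y : ℂ)), 1 + (x : ℂ), (y : ℂ)] : EuclideanSpace ℂ (Fin 3))‖ = 1 := by
      have : ‖(!₂[-(1 + (x : ℂ) + (y : ℂ)), 1 + (x : ℂ), (y : ℂ)] : EuclideanSpace ℂ (Fin 3))‖
          = N := by
        rw [EuclideanSpace.norm_eq, Fin.sum_univ_three]
        have e1 : ‖1 + (x : ℂ) + y‖ = |1 + x + y| := by
          rw [← Real.norm_eq_abs, ← Complex.norm_real]; push_cast; rfl
        have e2 : ‖1 + (x : ℂ)‖ = |1 + x| := by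
          rw [← Real.norm_eq_abs, ← Complex.norm_real]; push_cast; rfl
        simp only [Matrix.cons_val, norm_neg, e1, e2, Complex.norm_real, Real.norm_eq_abs, sq_abs]
        rfl
      rw [norm_smul, this, Complex.norm_real, Real.norm_eq_abs, abs_of_pos (by positivity)]
      field_simp
    have := congrArg norm heq
    rwa [norm_smul, hunit, mul_one, hφ, eq_comm] at this

/-! ### Momentum space -/

theorem momentumEvolution_apply (x y k : ℝ) (v : EuclideanSpace ℂ (Fin 3)) (l : Fin 3) :
    Matrix.toEuclideanLin (momentumEvolution (toComplex (coin x y)) k) v l =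
      ![Complex.exp (Complex.I * k) * (x * v 0 + y * v 1 + (-1 - x - y) * v 2),
        (-1 - x - y) * v 0 + x * v 1 + y * v 2,
        Complex.exp (-(Complex.I * k)) * (y * v 0 + (-1 - x - y) * v 1 + x * v 2)] l := by
  rw [momentumEvolution, Matrix.toLpLin_apply, ← Matrix.mulVec_mulVec]
  simp only [Matrix.mulVec_diagonal]
  fin_cases l <;> simp [Matrix.mulVec, dotProduct, Fin.sum_univ_three, toComplex, coin]

theorem hasEigenvalue_momentumEvolution {x y : ℝ} (h : x ^ 2 + y ^ 2 + x + y + x * y = 0)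
    (hx1 : x ≠ -1) (k : ℝ) :
    Module.End.HasEigenvalue
      (Matrix.toEuclideanLin (momentumEvolution (toComplex (coin x y)) k)) (-1) := by
  have hc : (x : ℂ) ^ 2 + y ^ 2 + x + y + x * y = 0 := by exact_mod_cast h
  have hxr : 1 + x ≠ 0 := fun h => hx1 (by linarith)
  have hx : (1 + x : ℂ) ≠ 0 := by exact_mod_cast hxr
  have hw : exp (I * k) * exp (-(I * k)) = 1 := by rw [← Complex.exp_add]; simp
  refine Module.End.hasEigenvalue_of_hasEigenvector
    -- The Fourier transform of `boundState x y (-1)` with kernel e^{-ikm}.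
    (x := !₂[exp (I * k) * (1 + x), (1 + x + y) * exp (I * k) - y, 1 + x]) ?_
  rw [Module.End.hasEigenvector_iff, Module.End.mem_eigenspace_iff]
  constructor
  · ext l
    rw [momentumEvolution_apply]
    generalize exp (I * k) = w, exp (-(I * k)) = w' at hw
    fin_cases l <;> simp
    · linear_combination (w ^ 2 - w) * hc
    · ring
    · linear_combination -(1 + x : ℂ) * hw + (w' - w * w') * hc
  · intro h0
    have := congrFun (congrArg WithLp.ofLp h0) 2
    simp [hx] at this

/-- The middle row of the eigenvector equation is free of k and is, up to conjugation and scaling,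
this orthogonality. -/
theorem inner_exceptionalState_eq_zero (x y k : ℝ) (v : EuclideanSpace ℂ (Fin 3))
    (hv : Matrix.toEuclideanLin (momentumEvolution (toComplex (coin x y)) k) v = -v) :
    inner ℂ v (exceptionalState x y) = 0 := by
  have h1 := congrFun (congrArg WithLp.ofLp hv) 1
  rw [momentumEvolution_apply] at h1
  have h2 : (-1 - x - y) * v 0 + x * v 1 + y * v 2 = -v 1 := by simpa using h1
  have hs := congrArg (starRingEnd ℂ) h2
  simp only [map_add, map_mul, map_sub, map_neg, map_one, conj_ofReal] at hs
  rw [exceptionalState, inner_smul_right, PiLp.inner_apply, Fin.sum_univ_three]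
  simp only [RCLike.inner_apply, Matrix.cons_val]
  refine mul_eq_zero_of_right _ ?_
  linear_combination hs

theorem eq_of_coin_mem_coinClassY {x y : ℝ} (hC : coin x y ∈ coinClassY) :
    x ^ 2 + y ^ 2 + x + y + x * y = 0 ∧ -1 ≤ x ∧ x ≤ 1 / 3 := by
  obtain ⟨x', y', h, h1, h2, e⟩ := hC
  have ex : x = x' := by simpa [coin] using congrFun (congrFun e 0) 0
  have ey : y = y' := by simpa [coin] using congrFun (congrFun e 0) 1
  subst ex ey
  exact ⟨h, h1, h2⟩

end ThreeStateWalk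

end

theorem mainTheorem4 (x y : ℝ) (hC : ThreeStateWalk.coin x y ∈ ThreeStateWalk.coinClassY)
    (hx0 : x ≠ 0) (hx1 : x ≠ -1) :
    -- the limit of the return probability exists, and vanishes exactly for one coin state
    -- (up to a global phase), which is the one with `D = E = 0`
    (∀ φ : EuclideanSpace ℂ (Fin 3), ‖φ‖ = 1 →
      ∃ L : ℝ,
        Tendsto (fun t : ℕ =>
          ThreeStateWalk.prob (ThreeStateWalk.toComplex (ThreeStateWalk.coin x y)) φ 0 t)
          atTop (𝓝 L) ∧
        (L = 0 ↔ ∃ c : ℂ, ‖c‖ = 1 ∧ φ = c • ThreeStateWalk.exceptionalState x y) ∧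
        (L = 0 ↔ φ 0 * (1 + x) + φ 1 * (1 + x + y) = 0 ∧ φ 2 * (1 + x) - φ 1 * y = 0)) ∧
    -- `-1` is an eigenvalue for every momentum, and this state is orthogonal to its eigenvectors
    (∀ k : ℝ,
      Module.End.HasEigenvalue (Matrix.toEuclideanLin (ThreeStateWalk.momentumEvolution
        (ThreeStateWalk.toComplex (ThreeStateWalk.coin x y)) k)) (-1) ∧
      ∀ v : EuclideanSpace ℂ (Fin 3),
        Matrix.toEuclideanLin (ThreeStateWalk.momentumEvolution
          (ThreeStateWalk.toComplex (ThreeStateWalk.coin x y)) k) v = -v →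
        inner ℂ v (ThreeStateWalk.exceptionalState x y) = 0) := by
  obtain ⟨h, h1, h2⟩ := ThreeStateWalk.eq_of_coin_mem_coinClassY hC
  refine ⟨fun φ hφ => ?_, fun k => ⟨ThreeStateWalk.hasEigenvalue_momentumEvolution h hx1 k,
    ThreeStateWalk.inner_exceptionalState_eq_zero x y k⟩⟩
  obtain ⟨L, hL, hdec, hzero⟩ := ThreeStateWalk.exists_limit_prob_zero h h1 h2 hx0 φ
  have hDE : L = 0 ↔
      φ 0 * (1 + x) + φ 1 * (1 + x + y) = 0 ∧ φ 2 * (1 + x) - φ 1 * y = 0 := by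
    refine ⟨fun h0 => ?_, fun ⟨hD, hE⟩ => hzero fun ξ hξ =>
      ThreeStateWalk.inner_initial_eq_zero_of_eq_neg hx1 hD hE hξ⟩
    have horth (m : ℤ) := ThreeStateWalk.inner_eq_zero_of_mem_decaying h
      (ThreeStateWalk.boundState_mem_span x y m) (ThreeStateWalk.walkOp_boundState h m) (hdec h0)
    have hin := ThreeStateWalk.inner_boundState_initial x y φ
    exact ⟨hin.1.symm.trans (horth 0), hin.2.symm.trans (horth (-1))⟩
  exact ⟨L, hL, hDE.trans (ThreeStateWalk.eq_smul_exceptionalState_iff hx1 hφ).symm, hDE⟩
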